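/- **Conventions.** Let $p$ be a prime and $B$ a Noetherian ring of characteristic $p$ that is F-finite (i.e. Frobenius $B\to B$ is a finite map). For $q=p^e$ and a $B$-module $M$ let $M^{1/q}$ be the group $M$, with elements written $x^{1/q}$, and with $B$-module structure $b\cdot x^{1/q}=(b^qx)^{1/q}$. The ring $B$ is *F-pure* if the $B$-linear map $B\to B^{1/p}$, $1\mapsto 1^{1/p}$, splits; it is *strongly F-regular* if for every $c\in B$ not in any minimal prime of $B$ there is $q=p^e$, $e\ge 1$, such that the $B$-linear map $B\to B^{1/q}$, $1\mapsto c^{1/q}$, splits. Let $A$ be an F-finite normal Noetherian domain of characteristic $p$ with fraction field $L$, and let $\Delta\ge 0$ be a $\mathbb Q$-Weil divisor on $Y=\operatorname{Spec}A$. For a $\mathbb Q$-Weil divisor $D$ put $A(D)=\{x\in L : x=0 \text{ or } \operatorname{div}_Y(x)+D\ge 0\}$. The pair $(A,\Delta)$ is * *F-pure* if $A\to A((q-1)\Delta)^{1/q}$, $1\mapsto 1^{1/q}$, splits as a map of $A$-modules for every $q=p^e$; * *strongly F-regular* if for every $c\ne 0$ in $A$ there is $q=p^e$, $e\ge1$,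 such that $A\to A((q-1)\Delta)^{1/q}$, $1\mapsto c^{1/q}$, splits as a map of $A$-modules; * *divisorially F-regular* if for every $c\neq 0$ in $A$ that is in no minimal prime of the ideal $A(-\lfloor\Delta\rfloor)\subseteq A$ there is $q=p^e$, $e\ge1$, such that $A\to A((q-1)\Delta)^{1/q}$, $1\mapsto c^{1/q}$, splits as a map of $A$-modules. For an ideal $I$, $I^{[q]}$ is the ideal generated by the $q$-th powers of the elements of $I$. **Statement.** Let $(R,\mathfrak m)$ be an F-finite regular local ring of characteristic $p>0$, let $f_1,\dots,f_s,g\in\mathfrak m$ ($s\ge0$) be an $R$-regular sequence, and suppose that $A=R/(f_1,\dots,f_s)$ is a normal domain. Let $\bar g$ be the image of $g$ in $A$, let $t\ge 0$ be a rational number, put $\Delta=t\cdot\operatorname{div}_Y(\bar g)$ on $Y=\operatorname{Spec}A$, and put $r_e=\lfloor t(p^e-1)\rfloor$. Then: 1. $(A,\Delta)$ is F-pure if and only if $(f_1\cdots f_s)^{q-1}g^{r_e}\notin\mathfrak m^{[q]}$ for all $q=p^e$, $e\ge 0$. 2. $(A,\Delta)$ is strongly F-regular if and only if $$\bigcap_{e\ge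 0}\bigl(\mathfrak m^{[p^e]}:(f_1\cdots f_s)^{p^e-1}g^{r_e}\bigr)=(f_1,\dots,f_s)\quad\text{in }R.$$ 3. $(A,\operatorname{div}_Y(\bar g))$ is F-pure (resp. divisorially F-regular) if and only if the ring $A/\bar gA=R/(f_1,\dots,f_s,g)$ is F-pure (resp. strongly F-regular). -/

import Mathlib

namespace FSing

noncomputable section

/-- `I^[q]`, the ideal generated by the `q`-th powers of the elements of `I`. -/
def frobeniusPower {R : Type*} [CommRing R] (I : Ideal R) (q : ℕ) : Ideal R :=
  Ideal.span ((fun x : R => x ^ q) '' (I : Set R))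

/-- A prime divisor of `Spec A`: a prime ideal of height one. -/
@[ext]
structure PrimeDivisor (A : Type*) [CommRing A] where
  asIdeal : Ideal A
  isPrime : asIdeal.IsPrime
  height_eq_one : asIdeal.height = 1

attribute [instance] PrimeDivisor.isPrime

/-- `ℚ`-Weil divisors on `Spec A`. -/
abbrev QDivisor (A : Type*) [CommRing A] : Type _ := PrimeDivisor A →₀ ℚ

theorem eq_bot_of_lt_of_height_eq_one {B : Type*} [CommRing B] [IsDomain B] {Q P : Ideal B}
    [Q.IsPrime] [P.IsPrime] (h : Q < P) (hP : P.height = 1) : Q = ⊥ := by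
  have h1 := Ideal.height_add_one_le_of_lt_of_isPrime h
  rw [hP] at h1
  refine Ideal.height_eq_zero_iff_eq_bot.mp (le_antisymm ?_ zero_le)
  have h2 : Q.height + 1 ≤ 0 + 1 := by simpa using h1
  exact (ENat.add_le_add_iff_right ENat.one_ne_top).mp h2

section Divisors

variable {A : Type*} [CommRing A] [IsDomain A]

/-- The local ring `A_P` at a prime divisor `P`, inside the fraction field of `A`. -/
abbrev PrimeDivisor.localRing (P : PrimeDivisor A) : Subalgebra A (FractionRing A) :=
  Localization.subalgebra.ofField (FractionRing A) P.asIdeal.primeCompl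
    P.asIdeal.primeCompl_le_nonZeroDivisors

instance PrimeDivisor.isLocalization_atPrime (P : PrimeDivisor A) :
    IsLocalization.AtPrime P.localRing P.asIdeal :=
  Localization.subalgebra.isLocalization_ofField (FractionRing A) P.asIdeal.primeCompl
    P.asIdeal.primeCompl_le_nonZeroDivisors

variable [IsNoetherianRing A] [IsIntegrallyClosed A]

/-- A normal Noetherian domain is regular in codimension one. -/
instance PrimeDivisor.isDiscreteValuationRing (P : PrimeDivisor A) :
    IsDiscreteValuationRing P.localRing := by
  have hM : P.asIdeal.primeCompl ≤ nonZeroDivisors A := P.asIdeal.primeCompl_le_nonZeroDivisors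
  have hloc : IsLocalRing P.localRing := IsLocalization.AtPrime.isLocalRing P.localRing P.asIdeal
  have hnoeth : IsNoetherianRing P.localRing :=
    IsLocalization.isNoetherianRing P.asIdeal.primeCompl P.localRing inferInstance
  have hic : IsIntegrallyClosed P.localRing :=
    isIntegrallyClosed_of_isLocalization P.localRing P.asIdeal.primeCompl hM
  have hdim : ringKrullDim P.localRing = 1 := by
    rw [IsLocalization.AtPrime.ringKrullDim_eq_height P.asIdeal P.localRing, P.height_eq_one]
    rfl
  have hfield : ¬ IsField P.localRing := fun h => by
    rw [ringKrullDim_eq_zero_of_isField h] at hdim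
    exact zero_ne_one hdim
  have hle : Ring.DimensionLEOne P.localRing := by
    refine ⟨fun {Q} hQ0 hQ => ?_⟩
    have hheight : (IsLocalRing.maximalIdeal P.localRing).height = 1 := by
      have h := IsLocalRing.maximalIdeal_height_eq_ringKrullDim (R := P.localRing)
      rw [hdim] at h
      exact_mod_cast h
    have hQm : Q = IsLocalRing.maximalIdeal P.localRing := by
      by_contra hne
      exact hQ0 (eq_bot_of_lt_of_height_eq_one
        (lt_of_le_of_ne (IsLocalRing.le_maximalIdeal hQ.ne_top) hne) hheight)
    rw [hQm]
    infer_instance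
  have hded : IsDedekindDomain P.localRing := { }
  exact ((IsDiscreteValuationRing.TFAE P.localRing hfield).out 0 2).mpr hded

/-- The order of vanishing of `x` along `P` (with the value `0` at `x = 0`). -/
def ordAt (P : PrimeDivisor A) (x : FractionRing A) : ℤ :=
  -WithZero.log ((IsDiscreteValuationRing.maximalIdeal P.localRing).valuation (FractionRing A) x)

theorem ordAt_mul (P : PrimeDivisor A) {x y : FractionRing A} (hx : x ≠ 0) (hy : y ≠ 0) :
    ordAt P (x * y) = ordAt P x + ordAt P y := by
  unfold ordAt
  rw [map_mul, WithZero.log_mul (by simpa using hx) (by simpa using hy)]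
  ring

theorem min_le_ordAt_add (P : PrimeDivisor A) {x y : FractionRing A} (hx : x ≠ 0) (hy : y ≠ 0)
    (hxy : x + y ≠ 0) : min (ordAt P x) (ordAt P y) ≤ ordAt P (x + y) := by
  unfold ordAt
  set v := (IsDiscreteValuationRing.maximalIdeal P.localRing).valuation (FractionRing A)
  have h := v.map_add x y
  have hx' : v x ≠ 0 := by simpa using hx
  have hy' : v y ≠ 0 := by simpa using hy
  have hxy' : v (x + y) ≠ 0 := by simpa using hxy
  rw [min_le_iff, neg_le_neg_iff, neg_le_neg_iff, WithZero.log_le_log hxy' hx',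
    WithZero.log_le_log hxy' hy']
  exact le_max_iff.mp h

theorem ordAt_algebraMap_nonneg (P : PrimeDivisor A) (a : A) :
    0 ≤ ordAt P (algebraMap A (FractionRing A) a) := by
  by_cases ha : a = 0
  · simp [ordAt, ha]
  unfold ordAt
  set v := (IsDiscreteValuationRing.maximalIdeal P.localRing).valuation (FractionRing A)
  have h : v (algebraMap A (FractionRing A) a) ≤ 1 := by
    rw [IsScalarTower.algebraMap_apply A P.localRing (FractionRing A)]
    exact IsDedekindDomain.HeightOneSpectrum.valuation_le_one _ _
  have hne : v (algebraMap A (FractionRing A) a) ≠ 0 := by simpa using ha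
  rw [neg_nonneg]
  simpa using (WithZero.log_le_log hne one_ne_zero).mpr h

theorem ordAt_algebraMap_eq_zero (P : PrimeDivisor A) {a : A} (ha : a ∉ P.asIdeal) :
    ordAt P (algebraMap A (FractionRing A) a) = 0 := by
  unfold ordAt
  have h : (IsDiscreteValuationRing.maximalIdeal P.localRing).valuation (FractionRing A)
      (algebraMap A (FractionRing A) a) = 1 := by
    rw [IsScalarTower.algebraMap_apply A P.localRing (FractionRing A),
      IsDedekindDomain.HeightOneSpectrum.valuation_eq_one_iff_notMem]
    intro hmem
    exact (IsLocalRing.mem_maximalIdeal _).mp hmem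
      (IsLocalization.map_units P.localRing (⟨a, ha⟩ : P.asIdeal.primeCompl))
  rw [h, WithZero.log_one, neg_zero]

/-- A nonzero element has zeros or poles along finitely many prime divisors only. -/
theorem finite_support_ordAt (x : FractionRing A) :
    (Function.support fun P : PrimeDivisor A => (ordAt P x : ℚ)).Finite := by
  have key : ∀ a : A, a ≠ 0 → {P : PrimeDivisor A | a ∈ P.asIdeal}.Finite := by
    intro a ha
    have hinj : Function.Injective (PrimeDivisor.asIdeal (A := A)) :=
      fun P Q h => PrimeDivisor.ext h
    refine Set.Finite.of_finite_image (f := PrimeDivisor.asIdeal) ?_ hinj.injOn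
    refine (Ideal.finite_minimalPrimes_of_isNoetherianRing A (Ideal.span {a})).subset ?_
    rintro _ ⟨P, hP, rfl⟩
    refine ⟨⟨P.isPrime, (Ideal.span_singleton_le_iff_mem _).mpr hP⟩, ?_⟩
    rintro Q ⟨hQ, hQa⟩ hQP
    by_contra hne
    have hlt : Q < P.asIdeal := lt_of_le_not_ge hQP hne
    have hQ0 : Q ≠ ⊥ := by
      rintro rfl
      exact ha (by simpa using hQa)
    exact hQ0 (eq_bot_of_lt_of_height_eq_one hlt P.height_eq_one)
  obtain ⟨a, b, hb, rfl⟩ := IsFractionRing.div_surjective A x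
  have hb0 : b ≠ 0 := nonZeroDivisors.ne_zero hb
  by_cases ha : a = 0
  · simp [ha, ordAt]
  refine ((key a ha).union (key b hb0)).subset ?_
  intro P hP
  by_contra hcon
  rw [Set.mem_union, not_or] at hcon
  apply hP
  have hbK : algebraMap A (FractionRing A) b ≠ 0 := by simpa using hb0
  have haK : algebraMap A (FractionRing A) a ≠ 0 := by simpa using ha
  have h := ordAt_mul P (div_ne_zero haK hbK) hbK
  rw [div_mul_cancel₀ _ hbK, ordAt_algebraMap_eq_zero P hcon.1,
    ordAt_algebraMap_eq_zero P hcon.2] at h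
  rw [add_zero] at h
  change ((ordAt P _ : ℤ) : ℚ) = 0
  rw [← h, Int.cast_zero]

/-- The principal divisor `div x` of an element `x ≠ 0` of the fraction field. -/
def principalDivisor (x : FractionRing A) : QDivisor A :=
  Finsupp.ofSupportFinite (fun P => (ordAt P x : ℚ)) (finite_support_ordAt x)

/-- The divisor `div a` of a nonzero element `a` of `A`. -/
abbrev divisorOf (a : A) : QDivisor A := principalDivisor (algebraMap A (FractionRing A) a)

/-- `A(D) = {x ∈ Frac A | div x + D ≥ 0}`, where `0` is included by convention. -/
def sections (D : QDivisor A) : Submodule A (FractionRing A) where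
  carrier := {x | x ≠ 0 → 0 ≤ principalDivisor x + D}
  zero_mem' := fun h => absurd rfl h
  add_mem' := by
    intro x y hx hy hxy
    by_cases hx0 : x = 0
    · subst hx0
      rw [zero_add] at hxy ⊢
      exact hy hxy
    by_cases hy0 : y = 0
    · subst hy0
      rw [add_zero] at hxy ⊢
      exact hx hxy
    intro P
    have h1 : (0 : ℚ) ≤ ordAt P x + D P := hx hx0 P
    have h2 : (0 : ℚ) ≤ ordAt P y + D P := hy hy0 P
    change (0 : ℚ) ≤ ordAt P (x + y) + D P
    have h3 := min_le_ordAt_add P hx0 hy0 hxy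
    rcases min_le_iff.mp h3 with h | h
    · have : (ordAt P x : ℚ) ≤ ordAt P (x + y) := by exact_mod_cast h
      linarith
    · have : (ordAt P y : ℚ) ≤ ordAt P (x + y) := by exact_mod_cast h
      linarith
  smul_mem' := by
    intro a x hx hax
    rw [Algebra.smul_def] at hax ⊢
    have ha0 : algebraMap A (FractionRing A) a ≠ 0 := left_ne_zero_of_mul hax
    have hx0 : x ≠ 0 := right_ne_zero_of_mul hax
    intro P
    have h1 : (0 : ℚ) ≤ ordAt P x + D P := hx hx0 P
    change (0 : ℚ) ≤ ordAt P (algebraMap A (FractionRing A) a * x) + D P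
    rw [ordAt_mul P ha0 hx0]
    have h2 : (0 : ℚ) ≤ ordAt P (algebraMap A (FractionRing A) a) := by
      exact_mod_cast ordAt_algebraMap_nonneg P a
    push_cast
    linarith

end Divisors

/-- Coefficientwise round-down of a `ℚ`-divisor. -/
def QDivisor.roundDown {A : Type*} [CommRing A] (D : QDivisor A) : QDivisor A :=
  Finsupp.mapRange (fun r : ℚ => ((⌊r⌋ : ℤ) : ℚ)) (by simp) D

/-- Let `M^{1/q}` denote the group `M`, its elements written as `x^{1/q}`, with the `A`-module
structure `a • x^{1/q} = (a ^ q • x)^{1/q}` (`q` a power of the characteristic). An `A`-linear map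
`M^{1/q} → A` is then the same as an additive map `φ : M → A` with `φ (a ^ q • x) = a * φ x`.
The predicate says that the `A`-linear map `A → M^{1/q}`, `1 ↦ x^{1/q}`, splits: some `A`-linear
map `M^{1/q} → A` sends `x^{1/q}` to `1`. -/
def SplitsRoot (A : Type*) [CommRing A] {M : Type*} [AddCommGroup M] [Module A M]
    (q : ℕ) (x : M) : Prop :=
  ∃ φ : M →+ A, (∀ (a : A) (y : M), φ (a ^ q • y) = a * φ y) ∧ φ x = 1

section Rings

variable (p : ℕ) (A : Type*) [CommRing A]

/-- The ring `A` of characteristic `p` is F-pure: `A → A^{1/p}` splits. -/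
def IsFPure : Prop := SplitsRoot A p (1 : A)

/-- The ring `A` of characteristic `p` is strongly F-regular: for every `c` outside all minimal
primes, `A → A^{1/q}`, `1 ↦ c^{1/q}`, splits for some `q = p ^ e`, `e ≥ 1`. -/
def IsStronglyFRegular : Prop :=
  ∀ c : A, (∀ P ∈ minimalPrimes A, c ∉ P) → ∃ e : ℕ, 1 ≤ e ∧ SplitsRoot A (p ^ e) c

end Rings

section Pairs

variable {A : Type*} [CommRing A] [IsDomain A] [IsNoetherianRing A] [IsIntegrallyClosed A]

/-- The map `A → A(D)^{1/q}`, `1 ↦ c^{1/q}`, splits as a map of `A`-modules. (For effective `D`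
one has `c ∈ A ⊆ A(D)` automatically.) -/
def PairSplits (q : ℕ) (c : A) (D : QDivisor A) : Prop :=
  ∃ h : algebraMap A (FractionRing A) c ∈ sections D,
    SplitsRoot A q (⟨algebraMap A (FractionRing A) c, h⟩ : sections D)

/-- The pair `(A, Δ)` is F-pure: `A → A((q - 1)Δ)^{1/q}` splits for every `q = p ^ e`. -/
def IsFPurePair (p : ℕ) (Δ : QDivisor A) : Prop :=
  ∀ e : ℕ, PairSplits (p ^ e) (1 : A) (((p : ℚ) ^ e - 1) • Δ)

/-- The pair `(A, Δ)` is strongly F-regular: for every `c ≠ 0` there is `q = p ^ e`, `e ≥ 1`, such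
that `A → A((q - 1)Δ)^{1/q}`, `1 ↦ c^{1/q}`, splits. -/
def IsStronglyFRegularPair (p : ℕ) (Δ : QDivisor A) : Prop :=
  ∀ c : A, c ≠ 0 → ∃ e : ℕ, 1 ≤ e ∧ PairSplits (p ^ e) c (((p : ℚ) ^ e - 1) • Δ)

/-- The ideal `A(-⌊Δ⌋)` of `A` attached to an effective `ℚ`-divisor `Δ`. -/
def roundDownIdeal (Δ : QDivisor A) : Ideal A :=
  (sections (-Δ.roundDown)).comap (Algebra.linearMap A (FractionRing A))

/-- The pair `(A, Δ)` is divisorially F-regular: for every `c ≠ 0` outside all minimal primes of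
`A(-⌊Δ⌋)` there is `q = p ^ e`, `e ≥ 1`, such that `A → A((q - 1)Δ)^{1/q}`, `1 ↦ c^{1/q}`,
splits. -/
def IsDivisoriallyFRegularPair (p : ℕ) (Δ : QDivisor A) : Prop :=
  ∀ c : A, c ≠ 0 → (∀ P ∈ (roundDownIdeal Δ).minimalPrimes, c ∉ P) →
    ∃ e : ℕ, 1 ≤ e ∧ PairSplits (p ^ e) c (((p : ℚ) ^ e - 1) • Δ)

end Pairs

end

end FSing

/-!
The Frobenius of a regular local ring `R` is flat: pushed forward along it, `R` is a finite module
on which a regular system of parameters acts as a regular sequence, hence is free. So `1 ↦ w^{1/q}`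
splits as soon as `w ∉ 𝔪^[q]`. Conversely, if `1 ↦ u^{1/q}` splits over `R/I`, `I = (f₁, …, f_s)`,
extend `f` to a maximal regular sequence `f, f'` and choose a socle element `y` modulo `(f, f')`.
Membership of `(f₁⋯f_s)^(q-1) u` in `𝔪^[q]` would put `u y^q` into `I + (f')^[q]`, and applying the
splitting would put `y` into `(f, f')`. This is Fedder's criterion for `R/I`.

For a pair with `Δ = t · div g`, multiplication by `g^{-r}` embeds `A` into `A((q-1)Δ)` whenever
`r ≤ t(q-1)`, and `x ↦ x^{q'} g^r` maps `A((q-1)Δ)` back to `A` whenever `t(q-1)q' ≤ r`. Passing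
from `q` to a larger `q q'` absorbs the rounding, so the splittings for the pair reduce to
splittings of `1 ↦ (c g^r)^{1/q}` over `A`, to which Fedder's criterion applies. When `t = 1` no
rounding occurs, and the criterion for `R/(f, g)` at `u` is the one for `R/(f)` at `u g^(q-1)`.
-/

namespace FSing

open IsLocalRing RingTheory.Sequence

section RegularLocalRing

theorem isLocalRing_quotient {R : Type*} [CommRing R] [IsLocalRing R] {I : Ideal R} (hI : I ≠ ⊤) :
    IsLocalRing (R ⧸ I) :=
  have := Ideal.Quotient.nontrivial_iff.mpr hI
  .of_surjective' (Ideal.Quotient.mk I) Ideal.Quotient.mk_surjective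

variable {R : Type*} [CommRing R] [IsLocalRing R]

theorem span_insert_erase_eq_maximalIdeal [DecidableEq R] {S : Finset R}
    (hS : Ideal.span (S : Set R) = maximalIdeal R) {x : R} (hx : x ∈ maximalIdeal R)
    (hx2 : x ∉ maximalIdeal R ^ 2) :
    ∃ a ∈ S, Ideal.span (insert x (S.erase a) : Finset R) = maximalIdeal R := by
  have hSm : ∀ a ∈ S, a ∈ maximalIdeal R := fun a ha => hS ▸ Ideal.subset_span ha
  obtain ⟨c, -, hc⟩ := Submodule.mem_span_finset.mp (hS.symm ▸ hx : x ∈ Ideal.span (S : Set R))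
  simp only [smul_eq_mul] at hc
  obtain ⟨a, ha, hca⟩ : ∃ a ∈ S, c a ∉ maximalIdeal R := by
    by_contra! hcon
    refine hx2 (hc ▸ sq (maximalIdeal R) ▸ Ideal.sum_mem _ fun a ha => ?_)
    exact Ideal.mul_mem_mul (hcon a ha) (hSm a ha)
  have hsub : ∀ b ∈ insert x (S.erase a), b ∈ Ideal.span (insert x (S.erase a) : Finset R) :=
    fun b hb => Ideal.subset_span hb
  have hmem : a ∈ Ideal.span (insert x (S.erase a) : Finset R) := by
    rw [← Ideal.unit_mul_mem_iff_mem _ (notMem_maximalIdeal.mp hca),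
      eq_sub_of_add_eq' ((Finset.sum_erase_add S (fun b => c b * b) ha).trans hc)]
    refine Ideal.sub_mem _ (hsub x (Finset.mem_insert_self _ _)) (Ideal.sum_mem _ fun b hb => ?_)
    exact Ideal.mul_mem_left _ _ (hsub b (Finset.mem_insert_of_mem hb))
  refine ⟨a, ha, le_antisymm ?_ ?_⟩
  · rw [Ideal.span_le]
    intro b hb
    rcases Finset.mem_insert.mp hb with rfl | hb
    · exact hx
    · exact hSm b (Finset.mem_of_mem_erase hb)
  · rw [← hS, Ideal.span_le]
    intro b hb
    by_cases hba : b = a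
    · exact hba ▸ hmem
    · exact hsub b (Finset.mem_insert_of_mem (Finset.mem_erase.mpr ⟨hba, hb⟩))

theorem maximalIdeal_notMem_minimalPrimes (hdim : ringKrullDim R ≠ 0) :
    maximalIdeal R ∉ minimalPrimes R := fun h =>
  hdim <| by rw [← maximalIdeal_height_eq_ringKrullDim, Ideal.height_eq_zero_iff.mpr h]; rfl

variable [IsNoetherianRing R]

theorem spanFinrank_maximalIdeal_quotient_add_one_le {x : R} [IsLocalRing (R ⧸ Ideal.span {x})]
    (hx : x ∈ maximalIdeal R) (hx2 : x ∉ maximalIdeal R ^ 2) :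
    (maximalIdeal (R ⧸ Ideal.span {x})).spanFinrank + 1 ≤ (maximalIdeal R).spanFinrank := by
  classical
  obtain ⟨S, hcard, hS⟩ :=
    Submodule.FG.exists_span_finset_card_eq_spanFinrank (IsNoetherian.noetherian (maximalIdeal R))
  obtain ⟨a, ha, hspan⟩ := span_insert_erase_eq_maximalIdeal hS hx hx2
  have hmap : maximalIdeal (R ⧸ Ideal.span {x}) =
      Ideal.span ((S.erase a).image (Ideal.Quotient.mk (Ideal.span {x}))) := by
    rw [← map_maximalIdeal_of_surjective _ Ideal.Quotient.mk_surjective, ← hspan, Ideal.map_span,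
      Finset.coe_insert, Set.image_insert_eq, Ideal.Quotient.mk_singleton_self,
      Ideal.span_insert_zero, Finset.coe_image]
  calc (maximalIdeal (R ⧸ Ideal.span {x})).spanFinrank + 1
      ≤ ((S.erase a).image (Ideal.Quotient.mk (Ideal.span {x}))).card + 1 := by
        rw [hmap, ← Set.ncard_coe_finset]
        gcongr
        exact Submodule.spanFinrank_span_le_ncard_of_finite (Finset.finite_toSet _)
    _ ≤ (S.erase a).card + 1 := by gcongr; exact Finset.card_image_le
    _ = (maximalIdeal R).spanFinrank := by rw [Finset.card_erase_add_one ha, hcard]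

theorem exists_mem_maximalIdeal_notMem_sq_notMem_minimalPrimes (hdim : ringKrullDim R ≠ 0) :
    ∃ x ∈ maximalIdeal R, x ∉ maximalIdeal R ^ 2 ∧ ∀ P ∈ minimalPrimes R, x ∉ P := by
  have hsq : ¬ maximalIdeal R ≤ maximalIdeal R ^ 2 := by
    intro hle
    have hbot : maximalIdeal R = ⊥ := by
      refine Submodule.eq_bot_of_le_smul_of_le_jacobson_bot (maximalIdeal R) _
        (IsNoetherian.noetherian _) ?_ (jacobson_eq_maximalIdeal _ bot_ne_top).ge
      rwa [smul_eq_mul, ← sq]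
    exact hdim (ringKrullDim_eq_zero_of_isField (isField_iff_maximalIdeal_eq.mpr hbot))
  have havoid := (Ideal.subset_union_prime_finite (f := id) (I := maximalIdeal R)
    ((minimalPrimes.finite_of_isNoetherianRing R).insert (maximalIdeal R ^ 2))
    (maximalIdeal R ^ 2) (maximalIdeal R ^ 2)
    fun P hP hne _ => (hP.resolve_left hne).1.1).not.mpr <| by
      rintro ⟨P, rfl | hP, hle⟩
      · exact hsq hle
      · have hPm := (le_maximalIdeal hP.1.1.ne_top).antisymm hle
        exact maximalIdeal_notMem_minimalPrimes hdim (hPm ▸ hP)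
  obtain ⟨x, hx, hx'⟩ := Set.not_subset.mp havoid
  simp only [Set.mem_iUnion, not_exists] at hx'
  exact ⟨x, hx, hx' _ (.inl rfl), fun P hP => hx' P (.inr hP)⟩

/-- A minimal prime `P ⊆ (x)` satisfies `P = xP`, hence vanishes by Nakayama. -/
theorem isDomain_of_isPrime_span_singleton {x : R} (hx : x ∈ maximalIdeal R)
    (hprime : (Ideal.span {x}).IsPrime) (hmin : ∀ P ∈ minimalPrimes R, x ∉ P) : IsDomain R := by
  obtain ⟨P, hP, hPx⟩ := Ideal.exists_minimalPrimes_le (I := ⊥) (J := Ideal.span {x}) bot_le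
  have hPprime : P.IsPrime := hP.1.1
  suffices P = ⊥ by subst this; exact IsDomain.of_bot_isPrime R
  refine Submodule.eq_bot_of_le_smul_of_le_jacobson_bot (Ideal.span {x}) _
    (IsNoetherian.noetherian _) (fun y hy => ?_) ?_
  · obtain ⟨z, rfl⟩ := Ideal.mem_span_singleton'.mp (hPx hy)
    rw [smul_eq_mul, mul_comm z x]
    exact Ideal.mul_mem_mul (Ideal.mem_span_singleton_self x)
      ((hPprime.mem_or_mem hy).resolve_right (hmin P hP))
  · rw [jacobson_eq_maximalIdeal _ bot_ne_top]
    exact (Ideal.span_singleton_le_iff_mem _).mpr hx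

end RegularLocalRing

theorem isRegularLocalRing_quotient_span_singleton {R : Type*} [CommRing R] [IsRegularLocalRing R]
    {x : R} (hx : x ∈ maximalIdeal R) (hx2 : x ∉ maximalIdeal R ^ 2) :
    IsRegularLocalRing (R ⧸ Ideal.span {x}) := by
  have := isLocalRing_quotient (ne_top_of_le_ne_top (maximalIdeal.isMaximal R).ne_top
    ((Ideal.span_singleton_le_iff_mem _).mpr hx))
  refine .of_spanFinrank_maximalIdeal_le _ (ENat.WithBot.add_le_add_one_right_iff.mp ?_)
  calc ((maximalIdeal (R ⧸ Ideal.span {x})).spanFinrank : WithBot ℕ∞) + 1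
      ≤ (maximalIdeal R).spanFinrank := by
        exact_mod_cast spanFinrank_maximalIdeal_quotient_add_one_le hx hx2
    _ = ringKrullDim R := IsRegularLocalRing.spanFinrank_maximalIdeal
    _ ≤ ringKrullDim (R ⧸ Ideal.span {x}) + 1 := by
        simpa using ringKrullDim_le_ringKrullDim_quotient_add_encard {x}
          (by simpa [ringJacobson_eq_maximalIdeal] using hx)

theorem maximalIdeal_eq_bot_of_ringKrullDim_eq_zero {R : Type*} [CommRing R] [IsRegularLocalRing R]
    (hdim : ringKrullDim R = 0) : maximalIdeal R = ⊥ := by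
  rw [← Submodule.spanFinrank_eq_zero_iff_eq_bot (IsNoetherian.noetherian _)]
  exact_mod_cast IsRegularLocalRing.spanFinrank_maximalIdeal.trans hdim

theorem isDomain_of_isRegularLocalRing (R : Type*) [CommRing R] [IsRegularLocalRing R] :
    IsDomain R := by
  by_cases hdim : ringKrullDim R = 0
  · exact (isField_iff_maximalIdeal_eq.mpr
      (maximalIdeal_eq_bot_of_ringKrullDim_eq_zero hdim)).isDomain
  obtain ⟨x, hx, hx2, hmin⟩ := exists_mem_maximalIdeal_notMem_sq_notMem_minimalPrimes hdim
  have := isRegularLocalRing_quotient_span_singleton hx hx2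
  have := spanFinrank_maximalIdeal_quotient_add_one_le hx hx2
  have := isDomain_of_isRegularLocalRing (R ⧸ Ideal.span {x})
  exact isDomain_of_isPrime_span_singleton hx ((Ideal.Quotient.isDomain_iff_prime _).mp this) hmin
termination_by (maximalIdeal R).spanFinrank

theorem isWeaklyRegular_cons_iff_quotient {R : Type*} [CommRing R] {x : R} {xs : List R} :
    IsWeaklyRegular R (x :: xs) ↔ IsSMulRegular R x ∧
      IsWeaklyRegular (R ⧸ Ideal.span {x}) (xs.map (Ideal.Quotient.mk (Ideal.span {x}))) := by
  have e : QuotSMulTop x R ≃ₗ[R] R ⧸ Ideal.span {x} := Submodule.quotEquivOfEq _ _ (by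
    rw [← Submodule.ideal_span_singleton_smul, smul_eq_mul, Ideal.mul_top])
  rw [isWeaklyRegular_cons_iff', LinearEquiv.isWeaklyRegular_congr
    (e.extendScalarsOfSurjective Ideal.Quotient.mk_surjective)]

theorem ofList_cons_eq_maximalIdeal {R : Type*} [CommRing R] [IsLocalRing R] {x : R} {xs : List R}
    [IsLocalRing (R ⧸ Ideal.span {x})]
    (h : Ideal.ofList (xs.map (Ideal.Quotient.mk (Ideal.span {x}))) =
      maximalIdeal (R ⧸ Ideal.span {x})) :
    Ideal.ofList (x :: xs) = maximalIdeal R := by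
  rw [Ideal.ofList_cons, sup_comm, ← Ideal.mk_ker (I := Ideal.span {x}),
    RingHom.ker_eq_comap_bot, ← Ideal.comap_map_of_surjective _ Ideal.Quotient.mk_surjective,
    Ideal.map_ofList, h]
  exact eq_maximalIdeal (Ideal.comap_isMaximal_of_surjective _ Ideal.Quotient.mk_surjective)

theorem exists_ofList_eq_maximalIdeal_isWeaklyRegular (R : Type*) [CommRing R]
    [IsRegularLocalRing R] :
    ∃ xs : List R, Ideal.ofList xs = maximalIdeal R ∧ IsWeaklyRegular R xs := by
  by_cases hdim : ringKrullDim R = 0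
  · exact ⟨[], by simp [maximalIdeal_eq_bot_of_ringKrullDim_eq_zero hdim], .nil R R⟩
  obtain ⟨x, hx, hx2, -⟩ := exists_mem_maximalIdeal_notMem_sq_notMem_minimalPrimes hdim
  have := isRegularLocalRing_quotient_span_singleton hx hx2
  have := spanFinrank_maximalIdeal_quotient_add_one_le hx hx2
  obtain ⟨xs', hxs', hreg⟩ := exists_ofList_eq_maximalIdeal_isWeaklyRegular (R ⧸ Ideal.span {x})
  obtain ⟨xs, rfl⟩ := List.map_surjective_iff.mpr Ideal.Quotient.mk_surjective xs'
  have := isDomain_of_isRegularLocalRing R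
  have hx0 : x ≠ 0 := fun h => hx2 (h ▸ zero_mem _)
  exact ⟨x :: xs, ofList_cons_eq_maximalIdeal hxs', isWeaklyRegular_cons_iff_quotient.mpr
    ⟨IsSMulRegular.of_ne_zero hx0, hreg⟩⟩
termination_by (maximalIdeal R).spanFinrank

section RegularSequences

variable {R M : Type*} [CommRing R] [AddCommGroup M] [Module R M]

theorem mkQ_mem_smul_top_iff {I : Ideal R} {N : Submodule R M} {x : M} :
    N.mkQ x ∈ I • (⊤ : Submodule R (M ⧸ N)) ↔ x ∈ N ⊔ I • (⊤ : Submodule R M) := by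
  rw [← Submodule.comap_map_mkQ, Submodule.mem_comap, Submodule.map_smul'', Submodule.map_top,
    Submodule.range_mkQ]

theorem isWeaklyRegular_concat_iff {l : List R} {a : R} :
    IsWeaklyRegular M (l ++ [a]) ↔ IsWeaklyRegular M l ∧
      IsSMulRegular (M ⧸ (Ideal.ofList l • ⊤ : Submodule R M)) a := by
  rw [isWeaklyRegular_append_iff, isWeaklyRegular_singleton_iff]

theorem mem_sup_of_pow_smul_mem_sup {N : Submodule R M} {a : R} (ha : IsSMulRegular (M ⧸ N) a)
    {q : ℕ} {x : M} (hx : a ^ q • x ∈ Ideal.span {a ^ (q + 1)} • ⊤ ⊔ N) :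
    x ∈ Ideal.span {a} • ⊤ ⊔ N := by
  rw [Submodule.ideal_span_singleton_smul] at hx ⊢
  obtain ⟨y, hy, n, hn, hyn⟩ := Submodule.mem_sup.mp hx
  obtain ⟨z, -, rfl⟩ := (Submodule.mem_smul_pointwise_iff_exists _ _ _).mp hy
  have hmem : a ^ q • (x - a • z) ∈ N := by
    rwa [smul_sub, smul_smul, ← pow_succ, ← hyn, add_sub_cancel_left]
  rw [← add_sub_cancel (a • z) x]
  exact Submodule.add_mem_sup (Submodule.smul_mem_pointwise_smul _ _ _ trivial)
    (mem_of_isSMulRegular_quotient_of_smul_mem (ha.pow q) hmem)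

theorem exists_ne_zero_forall_mem_smul_eq_zero [IsNoetherianRing R] [Module.Finite R M]
    {I : Ideal R} (h : ∀ a ∈ I, ¬ IsSMulRegular M a) : ∃ y : M, y ≠ 0 ∧ ∀ a ∈ I, a • y = 0 := by
  have hhom : ¬ Subsingleton (R ⧸ I →ₗ[R] M) := by
    rw [IsSMulRegular.subsingleton_linearMap_iff, Ideal.annihilator_quotient]
    exact fun ⟨a, ha, hreg⟩ => h a ha hreg
  have := not_subsingleton_iff_nontrivial.mp hhom
  obtain ⟨f, hf⟩ := exists_ne (0 : R ⧸ I →ₗ[R] M)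
  refine ⟨f 1, fun h1 => hf ?_, fun a ha => ?_⟩
  · refine LinearMap.ext fun x => ?_
    obtain ⟨r, rfl⟩ := Ideal.Quotient.mk_surjective x
    rw [← mul_one r, map_mul, map_one, ← Ideal.Quotient.algebraMap_eq, ← Algebra.smul_def, map_smul,
      h1, smul_zero, LinearMap.zero_apply]
  · rw [← map_smul, Algebra.smul_def, mul_one, Ideal.Quotient.algebraMap_eq,
      Ideal.Quotient.eq_zero_iff_mem.mpr ha, map_zero]

theorem exists_append_isWeaklyRegular_socle [IsNoetherianRing R] {I : Ideal R} (hI : I ≠ ⊤)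
    (l : List R) (hl : ∀ r ∈ l, r ∈ I) (h : IsWeaklyRegular R l) :
    ∃ l' : List R, (∀ r ∈ l', r ∈ I) ∧ IsWeaklyRegular R (l ++ l') ∧
      ∃ y ∉ Ideal.ofList (l ++ l'), ∀ a ∈ I, a * y ∈ Ideal.ofList (l ++ l') := by
  induction hK : Ideal.ofList l using WellFoundedGT.induction generalizing l with
  | ind K ih =>
    by_cases hex : ∃ a ∈ I, IsSMulRegular (R ⧸ Ideal.ofList l) a
    · obtain ⟨a, ha, hreg⟩ := hex
      have hlt : K < Ideal.ofList (l ++ [a]) := by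
        rw [← hK, Ideal.ofList_append, left_lt_sup, Ideal.ofList_singleton,
          Ideal.span_singleton_le_iff_mem]
        intro hal
        have h1 : (1 : R) ∈ Ideal.ofList l :=
          mem_of_isSMulRegular_quotient_of_smul_mem hreg (by rwa [smul_eq_mul, mul_one])
        exact hI ((Ideal.eq_top_iff_one I).mpr (Ideal.span_le.mpr hl h1))
      obtain ⟨l', hl', hreg', hy⟩ := ih _ hlt (l ++ [a])
        (List.forall_mem_append.mpr ⟨hl, List.forall_mem_singleton.mpr ha⟩)
        (isWeaklyRegular_concat_iff.mpr ⟨h, by rwa [smul_eq_mul, Ideal.mul_top]⟩) rfl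
      rw [← List.append_cons] at hreg' hy
      exact ⟨a :: l', List.forall_mem_cons.mpr ⟨ha, hl'⟩, hreg', hy⟩
    · push Not at hex
      obtain ⟨y, hy0, hy⟩ := exists_ne_zero_forall_mem_smul_eq_zero hex
      obtain ⟨y, rfl⟩ := Ideal.Quotient.mk_surjective y
      refine ⟨[], List.forall_mem_nil _, by rwa [List.append_nil], y, ?_⟩
      rw [List.append_nil]
      exact ⟨fun hmem => hy0 (Ideal.Quotient.eq_zero_iff_mem.mpr hmem),
        fun a ha => Ideal.Quotient.eq_zero_iff_mem.mp (hy a ha)⟩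

variable [IsLocalRing R]

theorem map_pow_mem_maximalIdeal {l : List R} (hl : ∀ r ∈ l, r ∈ maximalIdeal R) {q : ℕ}
    (hq : q ≠ 0) : ∀ r ∈ l.map (· ^ q), r ∈ maximalIdeal R := by
  simpa using fun r hr => Ideal.pow_mem_of_mem _ (hl r hr) q hq.bot_lt

theorem isWeaklyRegular_cons_iff_concat [IsNoetherian R M] {l : List R} {a : R}
    (hl : ∀ r ∈ l, r ∈ maximalIdeal R) (ha : a ∈ maximalIdeal R) :
    IsWeaklyRegular M (a :: l) ↔ IsWeaklyRegular M (l ++ [a]) := by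
  have hperm : (l ++ [a]).Perm (a :: l) := List.perm_append_singleton a l
  have hm : ∀ r ∈ a :: l, r ∈ maximalIdeal R := List.forall_mem_cons.mpr ⟨ha, hl⟩
  exact ⟨fun h => isWeaklyRegular_of_perm_of_subset_maximalIdeal h hperm.symm hm,
    fun h => isWeaklyRegular_of_perm_of_subset_maximalIdeal h hperm
      fun r hr => hm r (hperm.subset hr)⟩

theorem isWeaklyRegular_map_pow [IsNoetherian R M] {q : ℕ} (hq : q ≠ 0) {l : List R}
    (hl : ∀ r ∈ l, r ∈ maximalIdeal R) (h : IsWeaklyRegular M l) :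
    IsWeaklyRegular M (l.map (· ^ q)) := by
  induction l generalizing M with
  | nil => exact h
  | cons a l ih =>
    obtain ⟨ha, hl⟩ := List.forall_mem_cons.mp hl
    have hlq := map_pow_mem_maximalIdeal hl hq
    rw [isWeaklyRegular_cons_iff] at h
    have hcons : IsWeaklyRegular M (a :: l.map (· ^ q)) := .cons h.1 (ih hl h.2)
    rw [isWeaklyRegular_cons_iff_concat hlq ha, isWeaklyRegular_concat_iff] at hcons
    rw [List.map_cons, isWeaklyRegular_cons_iff_concat hlq (Ideal.pow_mem_of_mem _ ha q hq.bot_lt),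
      isWeaklyRegular_concat_iff]
    exact ⟨hcons.1, hcons.2.pow q⟩

/-- Cancelling one element at a time, from the left, keeps the hypothesis in the same form over
`M ⧸ aM`. -/
theorem mem_ofList_smul_top_of_prod_pow_smul_mem [IsNoetherian R M] {q : ℕ} {l : List R}
    (hl : ∀ r ∈ l, r ∈ maximalIdeal R) (h : IsWeaklyRegular M l) {x : M}
    (hx : l.prod ^ q • x ∈ Ideal.ofList (l.map (· ^ (q + 1))) • (⊤ : Submodule R M)) :
    x ∈ Ideal.ofList l • (⊤ : Submodule R M) := by
  induction l generalizing M with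
  | nil => simpa using hx
  | cons a l ih =>
    obtain ⟨ha, hl⟩ := List.forall_mem_cons.mp hl
    rw [isWeaklyRegular_cons_iff] at h
    have hcons : IsWeaklyRegular M (a :: l.map (· ^ (q + 1))) :=
      .cons h.1 (isWeaklyRegular_map_pow q.succ_ne_zero hl h.2)
    rw [isWeaklyRegular_cons_iff_concat (map_pow_mem_maximalIdeal hl q.succ_ne_zero) ha,
      isWeaklyRegular_concat_iff] at hcons
    rw [List.map_cons, Ideal.ofList_cons, Submodule.sup_smul, List.prod_cons, mul_pow,
      mul_smul] at hx
    have hcancel := mem_sup_of_pow_smul_mem_sup hcons.2 hx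
    rw [Submodule.ideal_span_singleton_smul, ← mkQ_mem_smul_top_iff, map_smul] at hcancel
    rw [Ideal.ofList_cons, Submodule.sup_smul, Submodule.ideal_span_singleton_smul,
      ← mkQ_mem_smul_top_iff]
    exact ih hl h.2 hcancel

end RegularSequences

section Free

theorem free_of_isWeaklyRegular {R : Type*} [CommRing R] [IsLocalRing R] [IsNoetherianRing R]
    {M : Type*} [AddCommGroup M] [Module R M] [Module.Finite R M] {xs : List R}
    (hxs : Ideal.ofList xs = maximalIdeal R) (hM : IsWeaklyRegular M xs) : Module.Free R M := by
  match xs with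
  | [] =>
    rw [Ideal.ofList_nil] at hxs
    let : Field R := (isField_iff_maximalIdeal_eq.mpr hxs.symm).toField
    infer_instance
  | x :: xs =>
    have hx : x ∈ maximalIdeal R := hxs ▸ Ideal.subset_span List.mem_cons_self
    have := isLocalRing_quotient (ne_top_of_le_ne_top (maximalIdeal.isMaximal R).ne_top
      ((Ideal.span_singleton_le_iff_mem _).mpr hx))
    have hmax : Ideal.ofList (xs.map (Ideal.Quotient.mk (Ideal.span {x}))) =
        maximalIdeal (R ⧸ Ideal.span {x}) := by
      rw [← map_maximalIdeal_of_surjective _ Ideal.Quotient.mk_surjective, ← hxs,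
        Ideal.ofList_cons, Ideal.map_sup, Ideal.map_quotient_self, bot_sup_eq, Ideal.map_ofList]
    rw [isWeaklyRegular_cons_iff'] at hM
    have := Module.Finite.of_restrictScalars_finite R (R ⧸ Ideal.span {x}) (QuotSMulTop x M)
    have hfree := free_of_isWeaklyRegular hmax hM.2
    have := Module.finitePresentation_of_finite R M
    exact (Module.free_quotSMulTop_iff_free R M
      (by rwa [jacobson_eq_maximalIdeal _ bot_ne_top]) hM.1).mp hfree
termination_by xs.length

theorem exists_linearMap_apply_eq_one {R M : Type*} [CommRing R] [IsLocalRing R] [AddCommGroup M]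
    [Module R M] [Module.Free R M] {w : M} (hw : w ∉ maximalIdeal R • (⊤ : Submodule R M)) :
    ∃ f : M →ₗ[R] R, f w = 1 := by
  let b := Module.Free.chooseBasis R M
  obtain ⟨i, hi⟩ : ∃ i, b.repr w i ∉ maximalIdeal R := by
    by_contra! hcon
    refine hw (b.linearCombination_repr w ▸ Submodule.sum_mem _ fun i _ => ?_)
    exact Submodule.smul_mem_smul (hcon i) trivial
  obtain ⟨v, hv⟩ := (notMem_maximalIdeal.mp hi).exists_left_inv
  exact ⟨v • b.coord i, hv⟩

theorem exists_addMonoidHom_apply_eq_one {R S : Type*} [CommRing R] [IsLocalRing R]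
    [IsNoetherianRing R] [CommRing S] {φ : R →+* S} (hφ : φ.Finite) {xs : List R}
    (hxs : Ideal.ofList xs = maximalIdeal R) (hreg : IsWeaklyRegular S (xs.map φ)) {w : S}
    (hw : w ∉ (maximalIdeal R).map φ) :
    ∃ ψ : S →+ R, (∀ a y, ψ (φ a * y) = a * ψ y) ∧ ψ w = 1 := by
  let := φ.toAlgebra
  have : Module.Finite R S := hφ
  have := free_of_isWeaklyRegular hxs
    ((isWeaklyRegular_map_algebraMap_iff (S := S) S xs).mp hreg)
  obtain ⟨f, hf⟩ := exists_linearMap_apply_eq_one (R := R) (w := w)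
    (by rwa [Ideal.smul_top_eq_map])
  exact ⟨f.toAddMonoidHom, fun a y => f.map_smul a y, hf⟩

end Free

theorem mem_sup_of_prod_pow_mul_mem_ofList_map_pow {R : Type*} [CommRing R] [IsLocalRing R]
    [IsNoetherianRing R] {q : ℕ} {l l' : List R} (hl : ∀ r ∈ l, r ∈ maximalIdeal R)
    (hl' : ∀ r ∈ l', r ∈ maximalIdeal R) (h : IsWeaklyRegular R (l ++ l')) {z : R}
    (hz : l.prod ^ q * z ∈ Ideal.ofList ((l ++ l').map (· ^ (q + 1)))) :
    z ∈ Ideal.ofList l ⊔ Ideal.ofList (l'.map (· ^ (q + 1))) := by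
  have hlq' := map_pow_mem_maximalIdeal hl' q.succ_ne_zero
  rw [isWeaklyRegular_append_iff] at h
  have hpow : IsWeaklyRegular R (l ++ l'.map (· ^ (q + 1))) :=
    (isWeaklyRegular_append_iff R _ _).mpr ⟨h.1, isWeaklyRegular_map_pow q.succ_ne_zero hl' h.2⟩
  have hperm : IsWeaklyRegular R (l'.map (· ^ (q + 1)) ++ l) :=
    isWeaklyRegular_of_perm_of_subset_maximalIdeal hpow List.perm_append_comm
      (List.forall_mem_append.mpr ⟨hl, hlq'⟩)
  have key := mem_ofList_smul_top_of_prod_pow_smul_mem (q := q) hl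
    ((isWeaklyRegular_append_iff R _ _).mp hperm).2 (x := Submodule.mkQ _ z)
  rw [← map_smul, mkQ_mem_smul_top_iff, mkQ_mem_smul_top_iff] at key
  simp only [smul_eq_mul, Ideal.mul_top] at key
  rw [sup_comm]
  refine key ?_
  rwa [sup_comm, ← Ideal.ofList_append, ← List.map_append]

section Fedder

variable {R : Type*} [CommRing R]

theorem map_mem_map_of_mem_frobeniusPower {B : Type*} [CommRing B] {π : R →+* B} {q : ℕ}
    {χ : R →+ B} (hχ : ∀ a y, χ (a ^ q * y) = π a * χ y) {I : Ideal R} {x : R}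
    (hx : x ∈ frobeniusPower I q) : χ x ∈ I.map π := by
  suffices ∀ c, χ (c * x) ∈ I.map π by simpa using this 1
  refine Submodule.span_induction ?_ (by simp) ?_ ?_ hx
  · rintro _ ⟨a, ha, rfl⟩ c
    rw [mul_comm, hχ]
    exact Ideal.mul_mem_right _ _ (Ideal.mem_map_of_mem π ha)
  · intro a b _ _ ha hb c
    rw [mul_add, map_add]
    exact Ideal.add_mem _ (ha c) (hb c)
  · intro d a _ ha c
    rw [smul_eq_mul, ← mul_assoc]
    exact ha _

theorem pow_mul_mem_frobeniusPower {I K : Ideal R} {y : R} (h : ∀ a ∈ I, a * y ∈ K) {q : ℕ} {x : R}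
    (hx : x ∈ frobeniusPower I q) : x * y ^ q ∈ frobeniusPower K q := by
  suffices frobeniusPower I q ≤ (frobeniusPower K q).colon {y ^ q} from
    Submodule.mem_colon_singleton.mp (this hx)
  refine Ideal.span_le.mpr ?_
  rintro _ ⟨a, ha, rfl⟩
  refine Submodule.mem_colon_singleton.mpr (Ideal.subset_span ⟨a * y, h a ha, ?_⟩)
  exact mul_pow a y q

theorem ofList_map_pow_le_frobeniusPower (l : List R) (q : ℕ) :
    Ideal.ofList (l.map (· ^ q)) ≤ frobeniusPower (Ideal.ofList l) q := by
  refine Ideal.span_le.mpr fun x hx => ?_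
  obtain ⟨a, ha, rfl⟩ := List.mem_map.mp hx
  exact Ideal.subset_span ⟨a, Ideal.subset_span ha, rfl⟩

theorem prod_pow_mul_mem_frobeniusPower {l : List R} {q : ℕ} {x : R} (hx : x ∈ Ideal.ofList l) :
    x * l.prod ^ q ∈ frobeniusPower (Ideal.ofList l) (q + 1) := by
  suffices Ideal.ofList l ≤ (frobeniusPower (Ideal.ofList l) (q + 1)).colon {l.prod ^ q} from
    Submodule.mem_colon_singleton.mp (this hx)
  refine Ideal.span_le.mpr fun a ha => Submodule.mem_colon_singleton.mpr ?_
  obtain ⟨c, hc⟩ := List.dvd_prod ha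
  rw [hc, mul_pow, smul_eq_mul, ← mul_assoc, ← pow_succ']
  exact Ideal.mul_mem_right _ _ (Ideal.subset_span ⟨a, Ideal.subset_span ha, rfl⟩)

theorem SplitsRoot.quotient {I : Ideal R} {q : ℕ} {u v : R}
    (hv : ∀ x ∈ I, x * v ∈ frobeniusPower I q) (h : SplitsRoot R q (u * v)) :
    SplitsRoot (R ⧸ I) q (Ideal.Quotient.mk I u) := by
  obtain ⟨ψ, hψ, hψu⟩ := h
  let φ : R →+ R ⧸ I :=
    ((Ideal.Quotient.mk I).toAddMonoidHom.comp ψ).comp (AddMonoidHom.mulRight v)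
  have hφ (x : R) : φ x = Ideal.Quotient.mk I (ψ (x * v)) := rfl
  refine ⟨QuotientAddGroup.lift I.toAddSubgroup φ fun x hx => ?_, fun a y => ?_, ?_⟩
  · have hmem := map_mem_map_of_mem_frobeniusPower (π := RingHom.id R) hψ (hv x hx)
    rw [Ideal.map_id] at hmem
    exact Ideal.Quotient.eq_zero_iff_mem.mpr hmem
  · obtain ⟨a, rfl⟩ := Ideal.Quotient.mk_surjective a
    obtain ⟨y, rfl⟩ := Ideal.Quotient.mk_surjective y
    change φ (a ^ q * y) = Ideal.Quotient.mk I a * φ y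
    rw [hφ, hφ, mul_assoc, ← smul_eq_mul (a ^ q), hψ, map_mul]
  · change φ u = 1
    rw [hφ, hψu, map_one]

variable (p : ℕ) [Fact p.Prime] [CharP R p]

theorem frobeniusPower_eq_map (I : Ideal R) (e : ℕ) :
    frobeniusPower I (p ^ e) = I.map (iterateFrobenius R p e) :=
  rfl

theorem frobeniusPower_ofList (l : List R) (e : ℕ) :
    frobeniusPower (Ideal.ofList l) (p ^ e) = Ideal.ofList (l.map (· ^ p ^ e)) := by
  rw [frobeniusPower_eq_map, Ideal.map_ofList]
  rfl

theorem iterateFrobenius_finite (hF : (frobenius R p).Finite) (e : ℕ) :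
    (iterateFrobenius R p e).Finite := by
  induction e with
  | zero =>
    rw [iterateFrobenius_zero]
    exact RingHom.Finite.id R
  | succ e ih =>
    rw [iterateFrobenius_add, iterateFrobenius_one]
    exact ih.comp hF

theorem splitsRoot_of_notMem_frobeniusPower [IsRegularLocalRing R] (hF : (frobenius R p).Finite)
    {e : ℕ} {w : R} (hw : w ∉ frobeniusPower (maximalIdeal R) (p ^ e)) :
    SplitsRoot R (p ^ e) w := by
  obtain ⟨xs, hxs, hreg⟩ := exists_ofList_eq_maximalIdeal_isWeaklyRegular R
  have hpow : IsWeaklyRegular R (xs.map (iterateFrobenius R p e)) :=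
    isWeaklyRegular_map_pow (pow_ne_zero e (Fact.out : p.Prime).ne_zero)
      (fun r hr => hxs ▸ Ideal.subset_span hr) hreg
  exact exists_addMonoidHom_apply_eq_one (iterateFrobenius_finite p hF e) hxs hpow hw

theorem prod_pow_mul_notMem_frobeniusPower [IsLocalRing R] [IsNoetherianRing R] {e : ℕ}
    {l : List R} (hl : ∀ r ∈ l, r ∈ maximalIdeal R) (hreg : IsWeaklyRegular R l) {u : R}
    (h : SplitsRoot (R ⧸ Ideal.ofList l) (p ^ e) (Ideal.Quotient.mk (Ideal.ofList l) u)) :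
    l.prod ^ (p ^ e - 1) * u ∉ frobeniusPower (maximalIdeal R) (p ^ e) := by
  intro hmem
  obtain ⟨φ, hφ, hφu⟩ := h
  obtain ⟨l', hl', hreg', y, hy, hym⟩ :=
    exists_append_isWeaklyRegular_socle (maximalIdeal.isMaximal R).ne_top l hl hreg
  have hcolon : u * y ^ p ^ e ∈ Ideal.ofList l ⊔ Ideal.ofList (l'.map (· ^ p ^ e)) := by
    have hq : p ^ e - 1 + 1 = p ^ e := Nat.sub_add_cancel (Nat.pow_pos (Fact.out : p.Prime).pos)
    have hsocle := pow_mul_mem_frobeniusPower hym hmem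
    rw [frobeniusPower_ofList, mul_assoc, ← hq, Nat.add_sub_cancel] at hsocle
    rw [← hq]
    exact mem_sup_of_prod_pow_mul_mem_ofList_map_pow hl hl' hreg' hsocle
  obtain ⟨a, ha, b, hb, hab⟩ := Submodule.mem_sup.mp hcolon
  have hb' : b ∈ frobeniusPower (Ideal.ofList l') (p ^ e) := ofList_map_pow_le_frobeniusPower _ _ hb
  have hyb : φ (Ideal.Quotient.mk _ b) = Ideal.Quotient.mk _ y := by
    rw [eq_sub_of_add_eq' hab, map_sub, Ideal.Quotient.eq_zero_iff_mem.mpr ha, sub_zero, mul_comm,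
      map_mul, map_pow, ← smul_eq_mul, hφ, hφu, mul_one]
  have hχ : ∀ a y, φ (Ideal.Quotient.mk (Ideal.ofList l) (a ^ p ^ e * y)) =
      Ideal.Quotient.mk _ a * φ (Ideal.Quotient.mk _ y) := fun a y => by
    rw [map_mul, map_pow, ← smul_eq_mul, hφ]
  have hmap := map_mem_map_of_mem_frobeniusPower
    (χ := φ.comp (Ideal.Quotient.mk (Ideal.ofList l)).toAddMonoidHom) hχ hb'
  change φ (Ideal.Quotient.mk _ b) ∈ _ at hmap
  rw [hyb, Ideal.mem_quotient_iff_mem_sup, sup_comm, ← Ideal.ofList_append] at hmap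
  exact hy hmap

theorem splitsRoot_quotient_iff [IsRegularLocalRing R] (hF : (frobenius R p).Finite) {e : ℕ}
    {l : List R} (hl : ∀ r ∈ l, r ∈ maximalIdeal R) (hreg : IsWeaklyRegular R l) {u : R} :
    SplitsRoot (R ⧸ Ideal.ofList l) (p ^ e) (Ideal.Quotient.mk (Ideal.ofList l) u) ↔
      l.prod ^ (p ^ e - 1) * u ∉ frobeniusPower (maximalIdeal R) (p ^ e) := by
  refine ⟨prod_pow_mul_notMem_frobeniusPower p hl hreg, fun h => ?_⟩
  have hq : p ^ e - 1 + 1 = p ^ e := Nat.sub_add_cancel (Nat.pow_pos (Fact.out : p.Prime).pos)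
  refine SplitsRoot.quotient (v := l.prod ^ (p ^ e - 1)) (fun x hx => ?_) ?_
  · exact hq ▸ prod_pow_mul_mem_frobeniusPower hx
  · rw [mul_comm]
    exact splitsRoot_of_notMem_frobeniusPower p hF h

end Fedder

section Hartogs

variable {A K : Type*} [CommRing A] [IsNoetherianRing A] [IsIntegrallyClosed A]
  [Field K] [Algebra A K] [IsFractionRing A K]

theorem exists_mem_exists_notMem_smul_eq {P : Ideal A} (hP : P ≠ ⊥) {y : K}
    (hPy : ∀ r ∈ P, r • y ∈ (Algebra.linearMap A K).range)
    (hy : y ∉ (Algebra.linearMap A K).range) :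
    ∃ r ∈ P, ∃ s ∉ P, algebraMap A K s = r • y := by
  by_contra! hall
  refine hy (IsIntegrallyClosed.isIntegral_iff.mp (isIntegral_of_smul_mem_submodule
    (Submodule.map (Algebra.linearMap A K) P) ?_ ((IsNoetherian.noetherian P).map _) y ?_))
  · obtain ⟨b, hb, hb0⟩ := (Submodule.ne_bot_iff _).mp hP
    refine (Submodule.ne_bot_iff _).mpr ⟨_, Submodule.mem_map_of_mem hb, ?_⟩
    simpa using hb0
  · rintro _ ⟨r, hr, rfl⟩
    obtain ⟨s, hs⟩ := hPy r hr
    refine ⟨s, by_contra fun hsP => hall r hr s hsP hs, ?_⟩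
    rw [hs, Algebra.smul_def, Algebra.linearMap_apply, smul_eq_mul, mul_comm]

theorem height_eq_one_of_forall_mem_iff_smul_mem {P : Ideal A} [P.IsPrime] {y : K}
    (hP : ∀ r, r ∈ P ↔ r • y ∈ (Algebra.linearMap A K).range) : P.height = 1 := by
  have : IsDomain A := IsDomain.of_faithfulSMul A K
  have hy : y ∉ (Algebra.linearMap A K).range := fun h =>
    (Ideal.ne_top_iff_one P).mp (Ideal.IsPrime.ne_top inferInstance)
      ((hP 1).mpr (by rwa [one_smul]))
  have hP0 : P ≠ ⊥ := by
    obtain ⟨a, b, hb, rfl⟩ := IsFractionRing.div_surjective A y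
    have hb0 : b ≠ 0 := nonZeroDivisors.ne_zero hb
    have hbK : algebraMap A K b ≠ 0 := by simpa using hb0
    refine (Submodule.ne_bot_iff _).mpr ⟨b, (hP b).mpr ⟨a, ?_⟩, hb0⟩
    rw [Algebra.linearMap_apply, Algebra.smul_def, mul_div_cancel₀ _ hbK]
  obtain ⟨r, hr, s, hs, hrs⟩ := exists_mem_exists_notMem_smul_eq hP0 (fun r => (hP r).mp) hy
  -- For `t ∈ P` one has `t * s = r * (t • y) ∈ (r)`, so `P` is minimal over `(r)`.
  have hmin : P ∈ (Ideal.span {r}).minimalPrimes := by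
    refine ⟨⟨inferInstance, (Ideal.span_singleton_le_iff_mem _).mpr hr⟩, ?_⟩
    rintro Q ⟨hQ, hrQ⟩ hQP t ht
    obtain ⟨u, hu⟩ := (hP t).mp ht
    have hts : t * s = r * u := by
      apply IsFractionRing.injective A K
      rw [Algebra.linearMap_apply] at hu
      rw [map_mul, map_mul, hu, hrs, Algebra.smul_def, Algebra.smul_def]
      ring
    have htsQ : t * s ∈ Q :=
      hts ▸ Ideal.mul_mem_right _ _ ((Ideal.span_singleton_le_iff_mem _).mp hrQ)
    exact (hQ.mem_or_mem htsQ).resolve_right fun h => hs (hQP h)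
  refine le_antisymm (Ideal.height_le_one_of_isPrincipal_of_mem_minimalPrimes _ P hmin) ?_
  rwa [Order.one_le_iff_ne_zero, ne_eq, Ideal.height_eq_zero_iff_eq_bot]

theorem exists_height_eq_one_le_of_notMem_range {x : K}
    (hx : x ∉ (Algebra.linearMap A K).range) :
    ∃ P : Ideal A, P.IsPrime ∧ P.height = 1 ∧
      ∀ s, s • x ∈ (Algebra.linearMap A K).range → s ∈ P := by
  set N := (Algebra.linearMap A K).range
  have hxN : N.mkQ x ≠ 0 := by
    rwa [Submodule.mkQ_apply, ne_eq, Submodule.Quotient.mk_eq_zero]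
  have hmem : ∀ y r, r ∈ (⊥ : Submodule A (K ⧸ N)).colon {N.mkQ y} ↔ r • y ∈ N := by
    intro y r
    rw [Submodule.mem_colon_singleton, Submodule.mem_bot, ← map_smul, Submodule.mkQ_apply,
      Submodule.Quotient.mk_eq_zero]
  obtain ⟨P, hP, hle⟩ := exists_le_isAssociatedPrime_of_isNoetherianRing A _ hxN
  obtain ⟨hprime, z, hz⟩ := isAssociatedPrime_iff.mp hP
  obtain ⟨y, rfl⟩ := N.mkQ_surjective z
  exact ⟨P, hprime, height_eq_one_of_forall_mem_iff_smul_mem fun r => by rw [← hmem, ← hz],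
    fun s hs => hle ((hmem x s).mpr hs)⟩

end Hartogs

section Divisors

variable {A : Type*} [CommRing A] [IsDomain A] [IsNoetherianRing A] [IsIntegrallyClosed A]

theorem exists_notMem_smul_mem_range_of_ordAt_nonneg (P : PrimeDivisor A) {x : FractionRing A}
    (hx : 0 ≤ ordAt P x) : ∃ s ∉ P.asIdeal,
      s • x ∈ (Algebra.linearMap A (FractionRing A)).range := by
  by_cases hx0 : x = 0
  · exact ⟨1, P.isPrime.one_notMem, by simp [hx0]⟩
  have hv : (IsDiscreteValuationRing.maximalIdeal P.localRing).valuation (FractionRing A) x ≤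
      1 := by
    rw [ordAt, neg_nonneg] at hx
    rwa [← WithZero.log_le_log (by simpa using hx0) one_ne_zero, WithZero.log_one]
  obtain ⟨y, rfl⟩ := IsDiscreteValuationRing.exists_lift_of_le_one hv
  obtain ⟨⟨a, s⟩, has⟩ := IsLocalization.surj P.asIdeal.primeCompl y
  refine ⟨s, s.2, a, ?_⟩
  rw [Algebra.smul_def, Algebra.linearMap_apply,
    IsScalarTower.algebraMap_apply A P.localRing (FractionRing A) a,
    IsScalarTower.algebraMap_apply A P.localRing (FractionRing A) s, ← map_mul, ← has, mul_comm]

theorem principalDivisor_mul {x y : FractionRing A} (hx : x ≠ 0) (hy : y ≠ 0) :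
    principalDivisor (x * y) = principalDivisor x + principalDivisor y := by
  ext P
  change ((ordAt P (x * y) : ℤ) : ℚ) = ordAt P x + ordAt P y
  rw [ordAt_mul P hx hy, Int.cast_add]

theorem principalDivisor_pow (x : FractionRing A) (n : ℕ) :
    principalDivisor (x ^ n) = n • principalDivisor x := by
  ext P
  change ((ordAt P (x ^ n) : ℤ) : ℚ) = n • (ordAt P x : ℚ)
  simp [ordAt]

theorem principalDivisor_inv (x : FractionRing A) :
    principalDivisor x⁻¹ = -principalDivisor x := by
  ext P
  change ((ordAt P x⁻¹ : ℤ) : ℚ) = -(ordAt P x : ℚ)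
  simp [ordAt]

theorem divisorOf_nonneg (a : A) : 0 ≤ divisorOf a := fun P => by
  change (0 : ℚ) ≤ (ordAt P _ : ℤ)
  exact_mod_cast ordAt_algebraMap_nonneg P a

theorem smul_divisorOf_le_smul_divisorOf {k k' : ℚ} (hk : k ≤ k') (h : A) :
    k • divisorOf h ≤ k' • divisorOf h :=
  smul_le_smul_of_nonneg_right hk (divisorOf_nonneg h)

theorem sections_mono : Monotone (sections : QDivisor A → Submodule A (FractionRing A)) :=
  fun _ _ h _ hx hx0 => (hx hx0).trans (by gcongr)

theorem mem_sections_neg_principalDivisor (x : FractionRing A) :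
    x ∈ sections (-principalDivisor x) := fun _ => (add_neg_cancel _).ge

theorem mul_mem_sections {D E : QDivisor A} {x y : FractionRing A} (hx : x ∈ sections D)
    (hy : y ∈ sections E) : x * y ∈ sections (D + E) := fun hxy => by
  have hx0 := left_ne_zero_of_mul hxy
  have hy0 := right_ne_zero_of_mul hxy
  rw [principalDivisor_mul hx0 hy0, add_add_add_comm]
  exact add_nonneg (hx hx0) (hy hy0)

theorem sections_zero :
    sections (0 : QDivisor A) = (Algebra.linearMap A (FractionRing A)).range := by
  ext x
  constructor
  · intro hx
    by_contra hxA
    obtain ⟨P, hP, hheight, hle⟩ := exists_height_eq_one_le_of_notMem_range hxA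
    have hx0 : x ≠ 0 := fun h => hxA (h ▸ zero_mem _)
    have hord : (0 : ℚ) ≤ ordAt ⟨P, hP, hheight⟩ x + 0 := hx hx0 ⟨P, hP, hheight⟩
    rw [add_zero, Int.cast_nonneg_iff] at hord
    obtain ⟨s, hs, hsx⟩ := exists_notMem_smul_mem_range_of_ordAt_nonneg _ hord
    exact hs (hle s hsx)
  · rintro ⟨a, rfl⟩ -
    rw [add_zero]
    exact divisorOf_nonneg a

theorem algebraMap_mem_sections {D : QDivisor A} (hD : 0 ≤ D) (a : A) :
    algebraMap A (FractionRing A) a ∈ sections D :=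
  sections_mono hD (sections_zero.ge ⟨a, rfl⟩)

theorem pow_mem_sections {D : QDivisor A} {x : FractionRing A} (hx : x ∈ sections D) (n : ℕ) :
    x ^ n ∈ sections (n • D) := by
  induction n with
  | zero => simpa using algebraMap_mem_sections (A := A) le_rfl 1
  | succ n ih =>
    rw [pow_succ, succ_nsmul]
    exact mul_mem_sections ih hx

theorem inv_pow_mem_sections (x : FractionRing A) (r : ℕ) :
    (x ^ r)⁻¹ ∈ sections (r • principalDivisor x) := by
  have h := mem_sections_neg_principalDivisor (x ^ r)⁻¹
  rwa [principalDivisor_inv, neg_neg, principalDivisor_pow] at h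

theorem roundDown_principalDivisor (x : FractionRing A) :
    QDivisor.roundDown (principalDivisor x) = principalDivisor x := by
  ext P
  exact congrArg Int.cast (Int.floor_intCast (R := ℚ) _)

theorem roundDownIdeal_divisorOf {h : A} (hh : h ≠ 0) :
    roundDownIdeal (divisorOf h) = Ideal.span {h} := by
  have hhK : algebraMap A (FractionRing A) h ≠ 0 := by simpa using hh
  ext a
  rw [Ideal.mem_span_singleton', roundDownIdeal, Submodule.mem_comap, roundDown_principalDivisor,
    Algebra.linearMap_apply]
  constructor
  · intro ha
    have hdiv := mul_mem_sections ha (inv_pow_mem_sections (algebraMap A (FractionRing A) h) 1)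
    rw [one_nsmul, neg_add_cancel, sections_zero, pow_one] at hdiv
    obtain ⟨b, hb⟩ := hdiv
    refine ⟨b, IsFractionRing.injective A (FractionRing A) ?_⟩
    rw [Algebra.linearMap_apply] at hb
    rw [map_mul, hb, inv_mul_cancel_right₀ hhK]
  · rintro ⟨b, rfl⟩
    have hmul := mul_mem_sections (algebraMap_mem_sections le_rfl b)
      (mem_sections_neg_principalDivisor (algebraMap A (FractionRing A) h))
    rwa [zero_add, ← map_mul] at hmul

end Divisors

section SplitsRoot

variable {A M N : Type*} [CommRing A] [AddCommGroup M] [Module A M] [AddCommGroup N] [Module A N]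

theorem SplitsRoot.of_apply {q n : ℕ} {x : M} (G : M →+ N)
    (hG : ∀ (a : A) y, G (a • y) = a ^ n • G y) (h : SplitsRoot A (q * n) (G x)) :
    SplitsRoot A q x := by
  obtain ⟨φ, hφ, hφx⟩ := h
  refine ⟨φ.comp G, fun a y => ?_, hφx⟩
  rw [AddMonoidHom.comp_apply, AddMonoidHom.comp_apply, hG, ← pow_mul, hφ]

theorem SplitsRoot.comp {q q' : ℕ} {x : M} (h : SplitsRoot A q (1 : A)) (h' : SplitsRoot A q' x) :
    SplitsRoot A (q * q') x := by
  obtain ⟨φ, hφ, hφ1⟩ := h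
  obtain ⟨ψ, hψ, hψx⟩ := h'
  refine ⟨φ.comp ψ, fun a y => ?_, by rw [AddMonoidHom.comp_apply, hψx, hφ1]⟩
  rw [pow_mul, AddMonoidHom.comp_apply, AddMonoidHom.comp_apply, hψ, ← smul_eq_mul, hφ]

theorem SplitsRoot.pow {q : ℕ} (h : SplitsRoot A q (1 : A)) (e : ℕ) :
    SplitsRoot A (q ^ e) (1 : A) := by
  induction e with
  | zero => exact ⟨AddMonoidHom.id A, by simp, rfl⟩
  | succ e ih =>
    rw [pow_succ]
    exact ih.comp h

theorem SplitsRoot.ne_zero [Nontrivial A] {q : ℕ} {x : M} (h : SplitsRoot A q x) : x ≠ 0 := by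
  rintro rfl
  obtain ⟨φ, -, hφ⟩ := h
  exact zero_ne_one ((map_zero φ).symm.trans hφ)

end SplitsRoot

section Exponents

theorem mul_pow_sub_one_nonneg (p : ℕ) [NeZero p] {t : ℚ} (ht : 0 ≤ t) (e : ℕ) :
    0 ≤ t * ((p : ℚ) ^ e - 1) := by
  have hpℚ : (1 : ℚ) ≤ p := by exact_mod_cast NeZero.one_le
  exact mul_nonneg ht (sub_nonneg.mpr (one_le_pow₀ hpℚ))

theorem exists_pow_mul_le_floor {p : ℕ} (hp : 1 < p) {t : ℚ} (ht : 0 ≤ t) (e : ℕ) :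
    ∃ e' : ℕ, (p : ℚ) ^ e' * (t * ((p : ℚ) ^ e - 1)) ≤ ⌊t * ((p : ℚ) ^ (e + e') - 1)⌋₊ := by
  rcases ht.eq_or_lt with rfl | ht0
  · exact ⟨0, by simp⟩
  have hpℚ : (1 : ℚ) < p := by exact_mod_cast hp
  obtain ⟨e', he'⟩ := pow_unbounded_of_one_lt (1 / t + 1) hpℚ
  have hgap : 1 ≤ t * ((p : ℚ) ^ e' - 1) := by
    rw [mul_comm, ← div_le_iff₀ ht0]
    linarith
  refine ⟨e', ?_⟩
  calc (p : ℚ) ^ e' * (t * ((p : ℚ) ^ e - 1))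
      = t * ((p : ℚ) ^ (e + e') - 1) - t * ((p : ℚ) ^ e' - 1) := by ring
    _ ≤ t * ((p : ℚ) ^ (e + e') - 1) - 1 := sub_le_sub_left hgap _
    _ ≤ ⌊t * ((p : ℚ) ^ (e + e') - 1)⌋₊ := (Nat.sub_one_lt_floor _).le

end Exponents

section Pairs

variable {A : Type*} [CommRing A] [IsDomain A] [IsNoetherianRing A] [IsIntegrallyClosed A]

theorem PairSplits.splitsRoot {q r : ℕ} {c h : A} (hh : h ≠ 0) {D : QDivisor A}
    (hD : r • divisorOf h ≤ D) (hs : PairSplits q c D) : SplitsRoot A q (c * h ^ r) := by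
  obtain ⟨hc, hs⟩ := hs
  have hhK : algebraMap A (FractionRing A) h ≠ 0 := by simpa using hh
  have hmem (a : A) :
      algebraMap A (FractionRing A) a * (algebraMap A (FractionRing A) h ^ r)⁻¹ ∈ sections D := by
    have := mul_mem_sections (algebraMap_mem_sections le_rfl a)
      (inv_pow_mem_sections (algebraMap A (FractionRing A) h) r)
    rw [zero_add] at this
    exact sections_mono hD this
  let divPow : A →ₗ[A] sections D := LinearMap.codRestrict _
    ((LinearMap.mulRight A (algebraMap A (FractionRing A) h ^ r)⁻¹).comp
      (Algebra.linearMap A (FractionRing A))) hmem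
  have hdivPow : divPow (c * h ^ r) = ⟨algebraMap A (FractionRing A) c, hc⟩ := by
    apply Subtype.ext
    change algebraMap A (FractionRing A) (c * h ^ r) * (algebraMap A (FractionRing A) h ^ r)⁻¹ = _
    rw [map_mul, map_pow, mul_inv_cancel_right₀ (pow_ne_zero r hhK)]
  refine SplitsRoot.of_apply (n := 1) divPow.toAddMonoidHom (fun a y => ?_) ?_
  · rw [pow_one]
    exact map_smul divPow a y
  · rw [mul_one]
    exact hdivPow ▸ hs

variable {p : ℕ} [Fact p.Prime]

theorem PairSplits.splitsRoot_floor {q : ℕ} {c h : A} (hh : h ≠ 0) {t : ℚ} (ht : 0 ≤ t) {e : ℕ}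
    (hs : PairSplits q c (((p : ℚ) ^ e - 1) • t • divisorOf h)) :
    SplitsRoot A q (c * h ^ ⌊t * ((p : ℚ) ^ e - 1)⌋₊) := by
  refine hs.splitsRoot hh ?_
  rw [smul_smul, mul_comm _ t, ← Nat.cast_smul_eq_nsmul ℚ]
  exact smul_divisorOf_le_smul_divisorOf (Nat.floor_le (mul_pow_sub_one_nonneg p ht e)) h

variable [CharP A p]

theorem exists_addMonoidHom_sections_pow_mul {D : QDivisor A} {e r : ℕ} {h : A}
    (hD : p ^ e • D ≤ r • divisorOf h) : ∃ G : sections D →+ A, ∀ x,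
      algebraMap A (FractionRing A) (G x) =
        (x : FractionRing A) ^ p ^ e * algebraMap A (FractionRing A) h ^ r := by
  have hinj := IsFractionRing.injective A (FractionRing A)
  have : CharP (FractionRing A) p := charP_of_injective_algebraMap hinj p
  have hex (x : sections D) : ∃ a, algebraMap A (FractionRing A) a =
      (x : FractionRing A) ^ p ^ e * algebraMap A (FractionRing A) h ^ r := by
    have hmul := mul_mem_sections (pow_mem_sections x.2 (p ^ e))
      (mem_sections_neg_principalDivisor (algebraMap A (FractionRing A) h ^ r))
    rw [principalDivisor_pow, ← sub_eq_add_neg] at hmul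
    exact sections_zero.le (sections_mono (sub_nonpos.mpr hD) hmul)
  choose G hG using hex
  refine ⟨AddMonoidHom.mk' G fun x y => hinj ?_, hG⟩
  rw [map_add, hG, hG, hG, Submodule.coe_add, add_pow_char_pow, add_mul]

theorem SplitsRoot.pairSplits {q e r : ℕ} {c h : A} {D : QDivisor A} (hD : 0 ≤ D)
    (hr : p ^ e • D ≤ r • divisorOf h) (hs : SplitsRoot A (q * p ^ e) (c ^ p ^ e * h ^ r)) :
    PairSplits q c D := by
  have hinj := IsFractionRing.injective A (FractionRing A)
  obtain ⟨G, hG⟩ := exists_addMonoidHom_sections_pow_mul hr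
  have hc := algebraMap_mem_sections hD c
  have hGc : G ⟨algebraMap A (FractionRing A) c, hc⟩ = c ^ p ^ e * h ^ r :=
    hinj (by simp only [hG, map_mul, map_pow])
  refine ⟨hc, SplitsRoot.of_apply G (fun a y => hinj ?_) (hGc ▸ hs)⟩
  rw [smul_eq_mul, map_mul, hG, hG, Submodule.coe_smul, Algebra.smul_def, mul_pow, map_pow,
    mul_assoc]

theorem pairSplits_smul_divisorOf_iff {e : ℕ} {c h : A} (hh : h ≠ 0) :
    PairSplits (p ^ e) c (((p : ℚ) ^ e - 1) • divisorOf h) ↔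
      SplitsRoot A (p ^ e) (c * h ^ (p ^ e - 1)) := by
  have hcoeff : ((p : ℚ) ^ e - 1) • divisorOf h = (p ^ e - 1) • divisorOf h := by
    rw [← Nat.cast_smul_eq_nsmul ℚ, Nat.cast_sub (Nat.pow_pos (Fact.out : p.Prime).pos)]
    simp only [Nat.cast_pow, Nat.cast_one]
  rw [hcoeff]
  refine ⟨fun hs => hs.splitsRoot hh le_rfl, fun hs => ?_⟩
  refine SplitsRoot.pairSplits (p := p) (e := 0) (nsmul_nonneg (divisorOf_nonneg h) _)
    (by rw [pow_zero, one_nsmul]) ?_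
  rwa [pow_zero, mul_one, pow_one]

theorem SplitsRoot.pairSplits_smul_smul {q e e' r : ℕ} {c h : A} {t : ℚ} (ht : 0 ≤ t)
    (hr : (p : ℚ) ^ e' * (t * ((p : ℚ) ^ e - 1)) ≤ r)
    (hs : SplitsRoot A (q * p ^ e') (c ^ p ^ e' * h ^ r)) :
    PairSplits q c (((p : ℚ) ^ e - 1) • t • divisorOf h) := by
  rw [smul_smul, mul_comm _ t]
  refine SplitsRoot.pairSplits ?_ ?_ hs
  · simpa using smul_divisorOf_le_smul_divisorOf (mul_pow_sub_one_nonneg p ht e) h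
  · rw [← Nat.cast_smul_eq_nsmul ℚ, ← Nat.cast_smul_eq_nsmul ℚ r, smul_smul, Nat.cast_pow]
    exact smul_divisorOf_le_smul_divisorOf hr h

variable (p)

theorem isFPurePair_smul_divisorOf_iff {h : A} (hh : h ≠ 0) {t : ℚ} (ht : 0 ≤ t) :
    IsFPurePair p (t • divisorOf h) ↔
      ∀ e : ℕ, SplitsRoot A (p ^ e) (h ^ ⌊t * ((p : ℚ) ^ e - 1)⌋₊) := by
  refine ⟨fun H e => ?_, fun H e => ?_⟩
  · simpa only [one_mul] using (H e).splitsRoot_floor hh ht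
  · obtain ⟨e', he'⟩ := exists_pow_mul_le_floor (Fact.out : p.Prime).one_lt ht e
    refine SplitsRoot.pairSplits_smul_smul ht he' ?_
    rw [one_pow, one_mul, ← pow_add]
    exact H (e + e')

theorem isStronglyFRegularPair_smul_divisorOf_iff {h : A} (hh : h ≠ 0) {t : ℚ} (ht : 0 ≤ t) :
    IsStronglyFRegularPair p (t • divisorOf h) ↔ ∀ c : A, c ≠ 0 →
      ∃ e : ℕ, 1 ≤ e ∧ SplitsRoot A (p ^ e) (c * h ^ ⌊t * ((p : ℚ) ^ e - 1)⌋₊) := by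
  refine ⟨fun H c hc => ?_, fun H c hc => ?_⟩
  · obtain ⟨e, he, hs⟩ := H c hc
    exact ⟨e, he, hs.splitsRoot_floor hh ht⟩
  -- Testing against `c * h` raises the exponent of `h` from `⌊t(q - 1)⌋` to above `t(q - 1)`.
  · obtain ⟨e, he, hs⟩ := H (c * h) (mul_ne_zero hc hh)
    refine ⟨e, he, SplitsRoot.pairSplits_smul_smul (e' := 0)
      (r := ⌊t * ((p : ℚ) ^ e - 1)⌋₊ + 1) ht ?_ ?_⟩
    · rw [pow_zero, one_mul]
      exact_mod_cast (Nat.lt_floor_add_one (t * ((p : ℚ) ^ e - 1))).le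
    · rwa [pow_zero, mul_one, pow_one, pow_succ', ← mul_assoc]

end Pairs

section MinimalPrimes

variable {R B : Type*} [CommRing R] [CommRing B]

theorem forall_minimalPrimes_map_notMem_iff {π : R →+* B} (hπ : Function.Surjective π)
    {K : Ideal B} {c : R} :
    (∀ P ∈ K.minimalPrimes, π c ∉ P) ↔ ∀ P ∈ (K.comap π).minimalPrimes, c ∉ P := by
  rw [Ideal.comap_minimalPrimes_eq_of_surjective hπ, Set.forall_mem_image]
  rfl

theorem comap_mk_span_singleton (I : Ideal R) (g : R) :
    (Ideal.span {Ideal.Quotient.mk I g}).comap (Ideal.Quotient.mk I) = I ⊔ Ideal.span {g} := by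
  rw [← Set.image_singleton, ← Ideal.map_span,
    Ideal.comap_map_of_surjective' _ Ideal.Quotient.mk_surjective, Ideal.mk_ker, sup_comm]

end MinimalPrimes

section Fedder

variable {R : Type*} [CommRing R]

theorem mk_ne_zero_of_isWeaklyRegular_concat {l : List R} [Nontrivial (R ⧸ Ideal.ofList l)] {g : R}
    (hreg : IsWeaklyRegular R (l ++ [g])) : Ideal.Quotient.mk (Ideal.ofList l) g ≠ 0 := by
  intro h0
  have hregular := (isWeaklyRegular_concat_iff.mp hreg).2
  rw [smul_eq_mul, Ideal.mul_top] at hregular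
  refine one_ne_zero (hregular (a₁ := (1 : R ⧸ Ideal.ofList l)) (a₂ := 0) ?_)
  simp only [Algebra.smul_def, Ideal.Quotient.algebraMap_eq, h0, zero_mul]

variable [IsRegularLocalRing R] (p : ℕ) [Fact p.Prime] [CharP R p]

theorem charP_quotient (I : Ideal R) [Nontrivial (R ⧸ I)] : CharP (R ⧸ I) p :=
  have := isDomain_of_isRegularLocalRing R
  CharP.of_ringHom_of_ne_zero (Ideal.Quotient.mk I) p (Fact.out : p.Prime).ne_zero

variable (hF : (frobenius R p).Finite) {l : List R} (hl : ∀ r ∈ l, r ∈ maximalIdeal R) {g : R}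

include hF hl

theorem splitsRoot_mk_mul_mk_pow_iff_notMem_colon (hreg : IsWeaklyRegular R l) {e r : ℕ} {x : R} :
    SplitsRoot (R ⧸ Ideal.ofList l) (p ^ e)
        (Ideal.Quotient.mk (Ideal.ofList l) x * Ideal.Quotient.mk (Ideal.ofList l) g ^ r) ↔
      x ∉ (frobeniusPower (maximalIdeal R) (p ^ e)).colon {l.prod ^ (p ^ e - 1) * g ^ r} := by
  rw [Submodule.mem_colon_singleton, smul_eq_mul, mul_left_comm,
    ← splitsRoot_quotient_iff p hF hl hreg, map_mul, map_pow]

theorem splitsRoot_quotient_concat_iff (hgm : g ∈ maximalIdeal R)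
    (hreg : IsWeaklyRegular R (l ++ [g])) {e : ℕ} {u : R} :
    SplitsRoot (R ⧸ Ideal.ofList (l ++ [g])) (p ^ e)
        (Ideal.Quotient.mk (Ideal.ofList (l ++ [g])) u) ↔
      SplitsRoot (R ⧸ Ideal.ofList l) (p ^ e) (Ideal.Quotient.mk (Ideal.ofList l) u *
        Ideal.Quotient.mk (Ideal.ofList l) g ^ (p ^ e - 1)) := by
  have hlg : ∀ r ∈ l ++ [g], r ∈ maximalIdeal R :=
    List.forall_mem_append.mpr ⟨hl, List.forall_mem_singleton.mpr hgm⟩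
  rw [splitsRoot_quotient_iff p hF hlg hreg, ← map_pow, ← map_mul,
    splitsRoot_quotient_iff p hF hl (isWeaklyRegular_concat_iff.mp hreg).1, List.prod_append,
    List.prod_singleton, mul_pow, mul_assoc, mul_comm u]

variable [IsDomain (R ⧸ Ideal.ofList l)] [IsIntegrallyClosed (R ⧸ Ideal.ofList l)]

theorem isFPurePair_smul_divisorOf_mk_iff (hreg : IsWeaklyRegular R l)
    (hg : Ideal.Quotient.mk (Ideal.ofList l) g ≠ 0) {t : ℚ} (ht : 0 ≤ t) :
    IsFPurePair p (t • divisorOf (Ideal.Quotient.mk (Ideal.ofList l) g)) ↔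
      ∀ e : ℕ, l.prod ^ (p ^ e - 1) * g ^ ⌊t * ((p : ℚ) ^ e - 1)⌋₊ ∉
        frobeniusPower (maximalIdeal R) (p ^ e) := by
  have := charP_quotient p (Ideal.ofList l)
  rw [isFPurePair_smul_divisorOf_iff p hg ht]
  simp only [← map_pow, splitsRoot_quotient_iff p hF hl hreg]

theorem isStronglyFRegularPair_smul_divisorOf_mk_iff (hreg : IsWeaklyRegular R l)
    (hgm : g ∈ maximalIdeal R) (hg : Ideal.Quotient.mk (Ideal.ofList l) g ≠ 0) {t : ℚ}
    (ht : 0 ≤ t) :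
    IsStronglyFRegularPair p (t • divisorOf (Ideal.Quotient.mk (Ideal.ofList l) g)) ↔
      ⨅ e : ℕ, (frobeniusPower (maximalIdeal R) (p ^ e)).colon
        {l.prod ^ (p ^ e - 1) * g ^ ⌊t * ((p : ℚ) ^ e - 1)⌋₊} = Ideal.ofList l := by
  have := charP_quotient p (Ideal.ofList l)
  rw [isStronglyFRegularPair_smul_divisorOf_iff p hg ht]
  refine ⟨fun H => le_antisymm (fun x hx => ?_) (le_iInf fun e x hx => ?_), fun H c hc => ?_⟩
  · by_contra hxI
    obtain ⟨e, -, hs⟩ := H _ (mt Ideal.Quotient.eq_zero_iff_mem.mp hxI)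
    exact (splitsRoot_mk_mul_mk_pow_iff_notMem_colon p hF hl hreg).mp hs (Ideal.mem_iInf.mp hx e)
  · by_contra hcolon
    have hs := (splitsRoot_mk_mul_mk_pow_iff_notMem_colon p hF hl hreg).mpr hcolon
    exact hs.ne_zero (by rw [Ideal.Quotient.eq_zero_iff_mem.mpr hx, zero_mul])
  · obtain ⟨x, rfl⟩ := Ideal.Quotient.mk_surjective c
    -- The factor `g ∈ 𝔪` excludes `e = 0`, where the colon ideal is `𝔪`.
    have hxg : x * g ∉ Ideal.ofList l := by
      rw [← Ideal.Quotient.eq_zero_iff_mem, map_mul]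
      exact mul_ne_zero hc hg
    rw [← H, Ideal.mem_iInf, not_forall] at hxg
    obtain ⟨e, he⟩ := hxg
    refine ⟨e, Nat.one_le_iff_ne_zero.mpr ?_, (splitsRoot_mk_mul_mk_pow_iff_notMem_colon p hF hl
      hreg).mpr fun h => he (Ideal.mul_mem_right _ _ h)⟩
    rintro rfl
    refine he (Submodule.mem_colon_singleton.mpr (Ideal.mul_mem_right _ _
      (Ideal.mul_mem_left _ _ (Ideal.subset_span ⟨g, hgm, ?_⟩))))
    simp

variable (hgm : g ∈ maximalIdeal R) (hreg : IsWeaklyRegular R (l ++ [g]))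

include hgm hreg

theorem pairSplits_divisorOf_mk_iff {e : ℕ} {c : R} :
    PairSplits (p ^ e) (Ideal.Quotient.mk (Ideal.ofList l) c)
        (((p : ℚ) ^ e - 1) • divisorOf (Ideal.Quotient.mk (Ideal.ofList l) g)) ↔
      SplitsRoot (R ⧸ Ideal.ofList (l ++ [g])) (p ^ e)
        (Ideal.Quotient.mk (Ideal.ofList (l ++ [g])) c) := by
  have := charP_quotient p (Ideal.ofList l)
  rw [pairSplits_smul_divisorOf_iff (mk_ne_zero_of_isWeaklyRegular_concat hreg),
    splitsRoot_quotient_concat_iff p hF hl hgm hreg]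

theorem isFPurePair_divisorOf_mk_iff :
    IsFPurePair p (divisorOf (Ideal.Quotient.mk (Ideal.ofList l) g)) ↔
      IsFPure p (R ⧸ Ideal.ofList (l ++ [g])) := by
  have hiff (e : ℕ) := pairSplits_divisorOf_mk_iff p hF hl hgm hreg (e := e) (c := 1)
  simp only [map_one] at hiff
  simp only [IsFPurePair, IsFPure, hiff]
  exact ⟨fun H => by simpa only [pow_one] using H 1, SplitsRoot.pow⟩

theorem isDivisoriallyFRegularPair_divisorOf_mk_iff :
    IsDivisoriallyFRegularPair p (divisorOf (Ideal.Quotient.mk (Ideal.ofList l) g)) ↔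
      IsStronglyFRegular p (R ⧸ Ideal.ofList (l ++ [g])) := by
  have hJ : Ideal.ofList l ⊔ Ideal.span {g} = Ideal.ofList (l ++ [g]) := by
    rw [Ideal.ofList_append, Ideal.ofList_singleton]
  have hJtop : Ideal.ofList (l ++ [g]) ≠ ⊤ := by
    refine ne_top_of_le_ne_top (maximalIdeal.isMaximal R).ne_top (Ideal.span_le.mpr ?_)
    exact List.forall_mem_append.mpr ⟨hl, List.forall_mem_singleton.mpr hgm⟩
  rw [IsDivisoriallyFRegularPair,
    roundDownIdeal_divisorOf (mk_ne_zero_of_isWeaklyRegular_concat hreg), IsStronglyFRegular,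
    Ideal.Quotient.mk_surjective.forall, Ideal.Quotient.mk_surjective.forall]
  refine forall_congr' fun c => ?_
  simp only [pairSplits_divisorOf_mk_iff p hF hl hgm hreg, minimalPrimes]
  rw [forall_minimalPrimes_map_notMem_iff Ideal.Quotient.mk_surjective, comap_mk_span_singleton, hJ,
    forall_minimalPrimes_map_notMem_iff Ideal.Quotient.mk_surjective, ← RingHom.ker_eq_comap_bot,
    Ideal.mk_ker]
  refine ⟨fun H hc => H (fun hc0 => ?_) hc, fun H _ hc => H hc⟩
  obtain ⟨P, hP⟩ := Ideal.nonempty_minimalPrimes hJtop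
  refine hc P hP (hP.1.2 (hJ ▸ Ideal.mem_sup_left ?_))
  exact Ideal.Quotient.eq_zero_iff_mem.mp hc0

end Fedder

end FSing

theorem corollary2p7
    (p : ℕ) [Fact p.Prime]
    (R : Type*) [CommRing R] [IsRegularLocalRing R] [CharP R p]
    (hFfinite : (frobenius R p).Finite)
    (s : ℕ) (f : Fin s → R) (g : R)
    (hf : ∀ i, f i ∈ IsLocalRing.maximalIdeal R) (hg : g ∈ IsLocalRing.maximalIdeal R)
    (hreg : RingTheory.Sequence.IsRegular R (List.ofFn f ++ [g]))
    (I : Ideal R) (hI : I = Ideal.span (Set.range f))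
    (J : Ideal R) (hJ : J = Ideal.span (Set.range f ∪ {g}))
    [IsDomain (R ⧸ I)] [IsIntegrallyClosed (R ⧸ I)]
    (t : ℚ) (ht : 0 ≤ t) :
    (FSing.IsFPurePair p (t • FSing.divisorOf (Ideal.Quotient.mk I g)) ↔
      ∀ e : ℕ, (∏ i, f i) ^ (p ^ e - 1) * g ^ ⌊t * ((p : ℚ) ^ e - 1)⌋₊ ∉
        FSing.frobeniusPower (IsLocalRing.maximalIdeal R) (p ^ e)) ∧
    (FSing.IsStronglyFRegularPair p (t • FSing.divisorOf (Ideal.Quotient.mk I g)) ↔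
      (⨅ e : ℕ, (FSing.frobeniusPower (IsLocalRing.maximalIdeal R) (p ^ e)).colon
        {(∏ i, f i) ^ (p ^ e - 1) * g ^ ⌊t * ((p : ℚ) ^ e - 1)⌋₊}) = I) ∧
    (FSing.IsFPurePair p (FSing.divisorOf (Ideal.Quotient.mk I g)) ↔
      FSing.IsFPure p (R ⧸ J)) ∧
    (FSing.IsDivisoriallyFRegularPair p (FSing.divisorOf (Ideal.Quotient.mk I g)) ↔
      FSing.IsStronglyFRegular p (R ⧸ J)) := by
  have hset : {r | r ∈ List.ofFn f} = Set.range f := Set.ext (List.mem_ofFn' f)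
  obtain rfl : I = Ideal.ofList (List.ofFn f) := by rw [hI, Ideal.ofList, hset]
  obtain rfl : J = Ideal.ofList (List.ofFn f ++ [g]) := by
    rw [hJ, Ideal.span_union, ← hI, Ideal.ofList_append, Ideal.ofList_singleton]
  have hl : ∀ r ∈ List.ofFn f, r ∈ IsLocalRing.maximalIdeal R := List.forall_mem_ofFn_iff.mpr hf
  have hlg := hreg.toIsWeaklyRegular
  have hlreg := (FSing.isWeaklyRegular_concat_iff.mp hlg).1
  have hg0 := FSing.mk_ne_zero_of_isWeaklyRegular_concat hlg
  rw [← List.prod_ofFn]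
  exact ⟨FSing.isFPurePair_smul_divisorOf_mk_iff p hFfinite hl hlreg hg0 ht,
    FSing.isStronglyFRegularPair_smul_divisorOf_mk_iff p hFfinite hl hlreg hg hg0 ht,
    FSing.isFPurePair_divisorOf_mk_iff p hFfinite hl hg hlg,
    FSing.isDivisoriallyFRegularPair_divisorOf_mk_iff p hFfinite hl hg hlg⟩
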